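/- Let $r\ge 1$ and let $P=P^{\mathrm{ROT}^r}_{X,Y}$ be the joint distribution of randomized $r$-bit string Rabin OT: for $x\in\{0,1\}^r$ and $y\in\{0,1\}^r\cup\{\bot\}$, $P(x,y)=2^{-r-1}$ if $y=x$ or $y=\bot$, and $P(x,y)=0$ otherwise. Let $A$ and $B$ be registers with computational bases $\{0,1\}^r$ and $\{0,1\}^r\cup\{\bot\}$, and let $A'$, $B'$ be arbitrary finite-dimensional working registers. A pure state $|\psi\rangle$ of $AA'BB'$ (with $AA'$ held by Alice and $BB'$ by Bob) is an *embedding* of $P$ if measuring $A$ and $B$ in the computational basis gives outcomes $(X,Y)$ with distribution $P$, and $S(X;YB')=S(XA';Y)=I(X;Y)$. Here $I$ is the Shannon mutual information and $S(M;N)=S(M)+S(N)-S(MN)$ is the quantum mutual information (von Neumann entropies; all logarithms are to base 2), and writing $X$ (resp. $Y$) in place of $A$ (resp. $B$) means that this register has been measured in the computational basis. Its *leakage* is $$\Delta_\psi=\max\{S(X;BB')-I(X;Y),\ S(AA';Y)-I(X;Y)\}.$$ **Theorem.** For every $r\ge1$, all embeddings of $P^{\mathrm{ROT}^r}_{X,Y}$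 have the same leakage $L(r)$. In particular, for every phase function $\theta$ with real values, the state $|\psi_\theta\rangle=\sum_{x,y}e^{i\theta(x,y)}\sqrt{P(x,y)}\,|x\rangle_A|y\rangle_B$ (trivial working registers) is an embedding of $P$ and has leakage $L(r)$. Moreover there is a constant $C$, independent of $r$, with $$1-C\,r2^{-r}\le L(r)\le 1\qquad\text{for all } r\ge1,$$ that is, $L(r)=1-O(r2^{-r})$; and for $r=1$, with $h(p)=-p\log_2p-(1-p)\log_2(1-p)$, $$L(1)=h(1/4)-\tfrac12\approx 0.311,$$ where the approximation means $|L(1)-0.311|<0.0005$. -/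

import Mathlib

namespace RabinLeakage

noncomputable section

/-! ### Entropies (all in bits) -/

/-- Shannon entropy of a finite distribution, in bits. -/
def shannonEntropy {ι : Type*} [Fintype ι] (p : ι → ℝ) : ℝ :=
  (∑ i, Real.negMulLog (p i)) / Real.log 2

/-- The binary entropy function `h`, in bits. -/
def binEntropyBits (p : ℝ) : ℝ := Real.binEntropy p / Real.log 2

/-- The Shannon mutual information `I(X;Y) = H(X) + H(Y) - H(X,Y)` of a joint distribution. -/
def mutualInfo {X Y : Type*} [Fintype X] [Fintype Y] (P : X → Y → ℝ) : ℝ :=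
  shannonEntropy (fun x => ∑ y, P x y) + shannonEntropy (fun y => ∑ x, P x y)
    - shannonEntropy (fun z : X × Y => P z.1 z.2)

/-- The von Neumann entropy (in bits) of a density matrix: the Shannon entropy of its eigenvalues,
counted with multiplicity, that is, of the roots of its characteristic polynomial. -/
def vonNeumannEntropy {n : Type*} [Fintype n] [DecidableEq n] (ρ : Matrix n n ℂ) : ℝ :=
  (ρ.charpoly.roots.map (fun z => Real.negMulLog z.re)).sum / Real.log 2

/-- On Hermitian matrices this is the Shannon entropy of the family of eigenvalues. -/
theorem vonNeumannEntropy_eq {n : Type*} [Fintype n] [DecidableEq n] {ρ : Matrix n n ℂ}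
    (h : ρ.IsHermitian) : vonNeumannEntropy ρ = shannonEntropy h.eigenvalues := by
  simp [vonNeumannEntropy, shannonEntropy, h.roots_charpoly_eq_eigenvalues]

/-! ### Operations on states -/

/-- Partial trace over the second of two systems. -/
def traceRight {m n : Type*} [Fintype n] (ρ : Matrix (m × n) (m × n) ℂ) : Matrix m m ℂ :=
  fun i j => ∑ k, ρ (i, k) (j, k)

/-- Partial trace over the first of two systems. -/
def traceLeft {m n : Type*} [Fintype m] (ρ : Matrix (m × n) (m × n) ℂ) : Matrix n n ℂ :=
  fun i j => ∑ k, ρ (k, i) (k, j)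

/-- The quantum mutual information `S(M;N) = S(M) + S(N) - S(MN)` of a bipartite state. -/
def quantumMutualInfo {m n : Type*} [Fintype m] [Fintype n] [DecidableEq m] [DecidableEq n]
    (ρ : Matrix (m × n) (m × n) ℂ) : ℝ :=
  vonNeumannEntropy (traceRight ρ) + vonNeumannEntropy (traceLeft ρ) - vonNeumannEntropy ρ

/-- The state after measuring, in the computational basis, the registers whose content is
read off by `f` (the outcome being kept in these registers): coherences between different
outcomes are erased. -/
def measured {n o : Type*} [DecidableEq o] (f : n → o) (ρ : Matrix n n ℂ) : Matrix n n ℂ :=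
  fun i j => if f i = f j then ρ i j else 0

/-! ### Two-party states, embeddings and leakage

A pure state of the registers `A, A'` (Alice) and `B, B'` (Bob) is given by its amplitudes in the
product basis. The bases of the output registers `A` and `B` are indexed by the alphabets `X`, `Y`;
the bases of the working registers `A'` and `B'` are indexed by arbitrary finite types `α`, `β`. -/

/-- Amplitudes of a pure state of the registers `(A, A'), (B, B')`. -/
abbrev State (X α Y β : Type*) := (X × α) × (Y × β) → ℂ

section States

variable {X α Y β : Type*} [Fintype X] [Fintype α] [Fintype Y] [Fintype β]
  [DecidableEq X] [DecidableEq α] [DecidableEq Y] [DecidableEq β]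

/-- The reduced state of the registers `A, (B, B')`. -/
def reducedABB' (ψ : State X α Y β) : Matrix (X × (Y × β)) (X × (Y × β)) ℂ :=
  fun i j => ∑ a, ψ ((i.1, a), i.2) * star (ψ ((j.1, a), j.2))

/-- The reduced state of the registers `(A, A'), B`. -/
def reducedAA'B (ψ : State X α Y β) : Matrix ((X × α) × Y) ((X × α) × Y) ℂ :=
  fun i j => ∑ b, ψ (i.1, (i.2, b)) * star (ψ (j.1, (j.2, b)))

/-- `S(X;BB')`: only `A` is measured. -/
def infoX_BB' (ψ : State X α Y β) : ℝ :=
  quantumMutualInfo (measured (fun i => i.1) (reducedABB' ψ))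

/-- `S(AA';Y)`: only `B` is measured. -/
def infoAA'_Y (ψ : State X α Y β) : ℝ :=
  quantumMutualInfo (measured (fun i => i.2) (reducedAA'B ψ))

/-- `S(X;YB')`: both `A` and `B` are measured. -/
def infoX_YB' (ψ : State X α Y β) : ℝ :=
  quantumMutualInfo (measured (fun i => (i.1, i.2.1)) (reducedABB' ψ))

/-- `S(XA';Y)`: both `A` and `B` are measured. -/
def infoXA'_Y (ψ : State X α Y β) : ℝ :=
  quantumMutualInfo (measured (fun i => (i.1.1, i.2)) (reducedAA'B ψ))

/-- `ψ` is an embedding of the primitive `P`: measuring `A` and `B` in the computational basis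
gives outcomes distributed according to `P`, and the working registers give no additional
information on the other party's output, i.e. `S(X;YB') = S(XA';Y) = I(X;Y)`. -/
structure IsEmbedding (P : X → Y → ℝ) (ψ : State X α Y β) : Prop where
  outcome : ∀ x y, ∑ a, ∑ b, ‖ψ ((x, a), (y, b))‖ ^ 2 = P x y
  bob : infoX_YB' ψ = mutualInfo P
  alice : infoXA'_Y ψ = mutualInfo P

/-- The leakage `max {S(X;BB') - I(X;Y), S(AA';Y) - I(X;Y)}`. -/
def leakage (P : X → Y → ℝ) (ψ : State X α Y β) : ℝ :=
  max (infoX_BB' ψ - mutualInfo P) (infoAA'_Y ψ - mutualInfo P)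

end States

/-- The regular embedding `∑ x y, exp (i θ(x,y)) √P(x,y) |x,y⟩` with phase function `θ`; its
working registers are trivial (one-dimensional). -/
def regularEmbedding {X Y : Type*} (P : X → Y → ℝ) (θ : X → Y → ℝ) : State X Unit Y Unit :=
  fun i => Complex.exp (Complex.I * (θ i.1.1 i.2.1 : ℂ)) * (Real.sqrt (P i.1.1 i.2.1) : ℂ)

/-! ### Randomized Rabin string OT -/

/-- Bit strings of length `r`. -/
abbrev BitString (r : ℕ) := Fin r → Bool

/-- Randomized `r`-bit string Rabin OT; the erasure symbol `⊥` of Bob is `none`. -/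
def rabinOT (r : ℕ) (x : BitString r) (y : Option (BitString r)) : ℝ :=
  if y = some x ∨ y = none then 1 / 2 ^ (r + 1) else 0

end

end RabinLeakage

namespace RabinLeakage

open Matrix Polynomial
open scoped ComplexOrder

set_option linter.unusedSectionVars false

/-! ### The entropy functional of an unnormalized state -/

/-! The two embedding conditions are equality cases of the concavity of entropy. Given `y`, the
distribution `rabinOT r` is constant on its support, so the states of `B'` for the various `x` enter
with equal weight. The inequality S(X;YB') ≥ I(X;Y) then splits into one Jensen inequality per `y`,
and equality forces those states to coincide (`IsEmbedding.bobCond_eq`; `IsEmbedding.aliceCond_eq`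
is the mirror image). Hence at an erasure `B'` is in one state σ, the same for all `x`, and `A'`
cannot tell an erasure from a transmission.

This fixes the spectrum of Alice's state up to σ: its nonzero eigenvalues are those of (1 + J) ⊗ σ,
with J the all-ones matrix of size 2^r. The identity comes from the outcomes y = x, and J from the
coherence between different `x` at ⊥. Since 1 + J has eigenvalues 1 and 2^r + 1, the entropy of
Alice's state is 2·2^r S(σ) plus an explicit term. The conditional entropies contain the same
multiple of S(σ), which cancels, and both differences in the leakage equal `rabinLeakage r`. With
trivial working registers the conditional states are 1×1 and the embedding conditions hold
automatically. The estimates for L come from bounding log₂(2^r + 1). -/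

/-- The entropy `-tr (ρ log ρ)`, in nats, of a matrix that need not have trace one. -/
noncomputable def spectralEntropy {n : Type*} [Fintype n] [DecidableEq n] (ρ : Matrix n n ℂ) : ℝ :=
  (ρ.charpoly.roots.map (fun z : ℂ => Real.negMulLog z.re)).sum

section SpectralEntropy

variable {m n o : Type*} [Fintype m] [Fintype n] [Fintype o]
  [DecidableEq m] [DecidableEq n] [DecidableEq o]

theorem vonNeumannEntropy_eq_spectralEntropy (ρ : Matrix n n ℂ) :
    vonNeumannEntropy ρ = spectralEntropy ρ / Real.log 2 := rfl

theorem spectralEntropy_eq_sum_eigenvalues {ρ : Matrix n n ℂ} (h : ρ.IsHermitian) :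
    spectralEntropy ρ = ∑ i, Real.negMulLog (h.eigenvalues i) := by
  simp [spectralEntropy, h.roots_charpoly_eq_eigenvalues]

theorem spectralEntropy_diagonal (d : n → ℂ) :
    spectralEntropy (diagonal d) = ∑ i, Real.negMulLog (d i).re := by
  rw [spectralEntropy, charpoly_diagonal, roots_prod _ _
    (Finset.prod_ne_zero_iff.2 fun i _ => X_sub_C_ne_zero _)]
  simp

theorem spectralEntropy_zero : spectralEntropy (0 : Matrix n n ℂ) = 0 := by
  rw [← diagonal_zero, spectralEntropy_diagonal]
  simp

theorem spectralEntropy_transpose (ρ : Matrix n n ℂ) :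
    spectralEntropy ρᵀ = spectralEntropy ρ := by
  rw [spectralEntropy, charpoly_transpose, spectralEntropy]

theorem spectralEntropy_reindex (e : m ≃ n) (ρ : Matrix m m ℂ) :
    spectralEntropy (reindex e e ρ) = spectralEntropy ρ := by
  rw [spectralEntropy, charpoly_reindex, spectralEntropy]

theorem spectralEntropy_submatrix (e : m ≃ n) (ρ : Matrix n n ℂ) :
    spectralEntropy (ρ.submatrix e e) = spectralEntropy ρ :=
  spectralEntropy_reindex e.symm ρ

/-- The two products differ only in the multiplicity of the eigenvalue 0, which carries no entropy.
This replaces the Schmidt decomposition: it exchanges the two sides of a pure state. -/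
theorem spectralEntropy_mul_comm (A : Matrix m n ℂ) (B : Matrix n m ℂ) :
    spectralEntropy (A * B) = spectralEntropy (B * A) := by
  have h := congrArg (fun p : ℂ[X] => (p.roots.map (fun z : ℂ => Real.negMulLog z.re)).sum)
    (charpoly_mul_comm' A B)
  have key (k : ℕ) (p : ℂ[X]) (hp : p ≠ 0) :
      ((X ^ k * p).roots.map (fun z : ℂ => Real.negMulLog z.re)).sum =
        (p.roots.map (fun z : ℂ => Real.negMulLog z.re)).sum := by
    rw [roots_mul (mul_ne_zero (pow_ne_zero _ X_ne_zero) hp)]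
    simp [Multiset.map_nsmul, Multiset.sum_nsmul]
  unfold spectralEntropy
  simpa only [key _ _ (charpoly_monic _).ne_zero] using h

theorem charpoly_blockDiagonal (M : o → Matrix n n ℂ) :
    (blockDiagonal M).charpoly = ∏ k, (M k).charpoly := by
  have : charmatrix (blockDiagonal M) = blockDiagonal fun k => charmatrix (M k) := by
    ext ⟨i, k⟩ ⟨j, l⟩ : 1
    by_cases hk : k = l
    · subst hk
      by_cases hi : i = j
      · subst hi; simp [charmatrix_apply_eq, blockDiagonal_apply]
      · simp [charmatrix_apply_ne, blockDiagonal_apply, hi]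
    · simp [charmatrix_apply_ne, blockDiagonal_apply, hk]
  rw [charpoly, this, det_blockDiagonal]
  rfl

theorem spectralEntropy_blockDiagonal (M : o → Matrix n n ℂ) :
    spectralEntropy (blockDiagonal M) = ∑ k, spectralEntropy (M k) := by
  rw [spectralEntropy, charpoly_blockDiagonal, roots_prod _ _
    (Finset.prod_ne_zero_iff.2 fun k _ => (charpoly_monic _).ne_zero), Multiset.map_bind,
    Multiset.sum_bind]
  rfl

theorem spectralEntropy_conj_unitary (U : unitaryGroup n ℂ) (ρ : Matrix n n ℂ) :
    spectralEntropy (star (U : Matrix n n ℂ) * ρ * (U : Matrix n n ℂ)) = spectralEntropy ρ := by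
  rw [spectralEntropy_mul_comm, ← mul_assoc, Unitary.mul_star_self_of_mem U.2, one_mul]

/-- Behaviour of the entropy under scaling by a real number. -/
theorem spectralEntropy_smul {ρ : Matrix n n ℂ} (h : ρ.IsHermitian) (c : ℝ) :
    spectralEntropy ((c : ℂ) • ρ) =
      c * spectralEntropy ρ + Real.negMulLog c * ρ.trace.re := by
  have h1 : star (h.eigenvectorUnitary : Matrix n n ℂ) * ((c : ℂ) • ρ) * h.eigenvectorUnitary =
      diagonal fun i => ((c * h.eigenvalues i : ℝ) : ℂ) := by
    have := h.conjStarAlgAut_star_eigenvectorUnitary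
    rw [Unitary.conjStarAlgAut_star_apply] at this
    rw [Matrix.mul_smul, Matrix.smul_mul, this]
    ext i j
    by_cases hij : i = j
    · subst hij; simp
    · simp [hij]
  rw [← spectralEntropy_conj_unitary h.eigenvectorUnitary, h1, spectralEntropy_diagonal,
    h.trace_eq_sum_eigenvalues, spectralEntropy_eq_sum_eigenvalues h]
  simp only [Complex.ofReal_re, Real.negMulLog_mul, Finset.sum_add_distrib, Finset.mul_sum,
    Complex.re_sum, Complex.coe_algebraMap, add_comm]
  simp [mul_comm]

/-- The diagonal of a positive semidefinite matrix has at least the entropy of its spectrum. -/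
theorem spectralEntropy_le_sum_diag {D : Matrix n n ℂ} (hD : D.PosSemidef) :
    spectralEntropy D ≤ ∑ j, Real.negMulLog (D j j).re ∧
      (spectralEntropy D = ∑ j, Real.negMulLog (D j j).re → D = diagonal fun j => D j j) := by
  have h := hD.1
  set V : Matrix n n ℂ := (h.eigenvectorUnitary : Matrix n n ℂ) with hV
  have hDV : ∀ i j, D i j = ∑ k, V i k * (h.eigenvalues k : ℂ) * star (V j k) := by
    intro i j
    conv_lhs => rw [h.spectral_theorem, Unitary.conjStarAlgAut_apply]
    simp [Matrix.mul_apply, diagonal_apply, hV, star_eq_conjTranspose]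
  have hVV : V * star V = 1 := Unitary.mul_star_self_of_mem h.eigenvectorUnitary.2
  have hVV' : star V * V = 1 := Unitary.star_mul_self_of_mem h.eigenvectorUnitary.2
  have hrow : ∀ i j, ∑ k, V i k * star (V j k) = if i = j then 1 else 0 := by
    intro i j
    have := congrFun (congrFun hVV i) j
    simpa [Matrix.mul_apply, one_apply, star_eq_conjTranspose] using this
  -- The matrix of squared moduli is doubly stochastic, so the diagonal of `D` is an average of
  -- eigenvalues and Jensen applies row by row.
  have hcol : ∀ k, ∑ j, ‖V j k‖ ^ 2 = 1 := by
    intro k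
    have := congrFun (congrFun hVV' k) k
    simp only [Matrix.mul_apply, star_eq_conjTranspose, conjTranspose_apply, one_apply_eq,
      RCLike.star_def, Complex.conj_mul'] at this
    exact_mod_cast this
  have hrow' : ∀ j, ∑ k, ‖V j k‖ ^ 2 = 1 := by
    intro j
    have := hrow j j
    simp only [RCLike.star_def, Complex.mul_conj', if_true] at this
    exact_mod_cast this
  have hdiag : ∀ j, (D j j).re = ∑ k, ‖V j k‖ ^ 2 • h.eigenvalues k := by
    intro j
    have : D j j = ((∑ k, ‖V j k‖ ^ 2 • h.eigenvalues k : ℝ) : ℂ) := by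
      rw [hDV]
      push_cast
      refine Finset.sum_congr rfl fun k _ => ?_
      rw [mul_right_comm, RCLike.star_def, Complex.mul_conj']
      simp
    rw [this, Complex.ofReal_re]
  have hpos : ∀ k ∈ Finset.univ, h.eigenvalues k ∈ Set.Ici (0 : ℝ) := fun k _ =>
    hD.eigenvalues_nonneg k
  have hent : spectralEntropy D = ∑ j, ∑ k, ‖V j k‖ ^ 2 • Real.negMulLog (h.eigenvalues k) := by
    rw [Finset.sum_comm, spectralEntropy_eq_sum_eigenvalues h]
    refine Finset.sum_congr rfl fun k _ => ?_
    rw [← Finset.sum_smul, hcol, one_smul]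
  have hle : ∀ j ∈ Finset.univ, ∑ k, ‖V j k‖ ^ 2 • Real.negMulLog (h.eigenvalues k) ≤
      Real.negMulLog (D j j).re := fun j _ => by
    rw [hdiag]
    exact Real.concaveOn_negMulLog.le_map_sum (fun _ _ => by positivity) (hrow' j) hpos
  refine ⟨hent ▸ Finset.sum_le_sum hle, fun heq => ?_⟩
  rw [hent, Finset.sum_eq_sum_iff_of_le hle] at heq
  -- Equality in Jensen: all eigenvalues that occur in row `j` agree, hence equal `D j j`. Then V Λ
  -- V* reduces to diag(D) V V*, which is diagonal.
  have hev : ∀ j k, V j k * (h.eigenvalues k : ℂ) = V j k * ((D j j).re : ℂ) := by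
    intro j k
    have h2 := heq j (Finset.mem_univ j)
    rw [hdiag j] at h2
    have h3 := (Real.strictConcaveOn_negMulLog.map_sum_eq_iff_of_nonneg
      (fun _ _ => by positivity) (hrow' j) hpos).1 h2.symm
    by_cases hz : V j k = 0
    · simp [hz]
    · rw [hdiag j]
      congr 2
      rw [← one_smul ℝ (h.eigenvalues k), ← hrow' j, Finset.sum_smul]
      refine Finset.sum_congr rfl fun l hl => ?_
      by_cases hz' : V j l = 0
      · simp [hz']
      · rw [h3 (Finset.mem_univ k) (by positivity) hl (by positivity)]
  ext i j
  rw [hDV, Finset.sum_congr rfl fun k _ => by rw [hev i k]]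
  have : ∀ k, V i k * ((D i i).re : ℂ) * star (V j k) =
      ((D i i).re : ℂ) * (V i k * star (V j k)) := fun k => by ring
  rw [Finset.sum_congr rfl fun k _ => this k, ← Finset.mul_sum, hrow, diagonal_apply]
  split_ifs
  · rw [mul_one]
    exact Complex.conj_eq_iff_re.1 (h.apply i i)
  · rw [mul_zero]

/-- Strict concavity of the von Neumann entropy. -/
theorem spectralEntropy_concave {ι : Type*} {s : Finset ι} {w : ι → ℝ} {B : ι → Matrix n n ℂ}
    (hw : ∀ i ∈ s, 0 < w i) (hw1 : ∑ i ∈ s, w i = 1) (hB : ∀ i ∈ s, (B i).PosSemidef) :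
    ∑ i ∈ s, w i * spectralEntropy (B i) ≤ spectralEntropy (∑ i ∈ s, (w i : ℂ) • B i) ∧
      (∑ i ∈ s, w i * spectralEntropy (B i) = spectralEntropy (∑ i ∈ s, (w i : ℂ) • B i) →
        ∀ i ∈ s, B i = ∑ i ∈ s, (w i : ℂ) • B i) := by
  set C := ∑ i ∈ s, (w i : ℂ) • B i with hC
  have hCp : C.PosSemidef := posSemidef_sum _ fun i hi =>
    (hB i hi).smul (by exact_mod_cast (hw i hi).le)
  -- In the eigenbasis of the mixture, two inequalities are chained: each part has at most the
  -- entropy of its diagonal, and Jensen compares these diagonals with the spectrum of `C`.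
  set U := hCp.1.eigenvectorUnitary
  let D : ι → Matrix n n ℂ := fun i => star (U : Matrix n n ℂ) * B i * U
  have hD : ∀ i ∈ s, (D i).PosSemidef := fun i hi => (hB i hi).conjTranspose_mul_mul_same _
  have hUC : star (U : Matrix n n ℂ) * C * U =
      diagonal fun j => ((hCp.1.eigenvalues j : ℝ) : ℂ) := by
    have := hCp.1.conjStarAlgAut_star_eigenvectorUnitary
    rw [Unitary.conjStarAlgAut_star_apply] at this
    exact this
  have hsum : ∀ j, hCp.1.eigenvalues j = ∑ i ∈ s, w i • (D i j j).re := by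
    intro j
    have h1 : star (U : Matrix n n ℂ) * C * U = ∑ i ∈ s, (w i : ℂ) • D i := by
      simp only [hC, D, Matrix.mul_sum, Matrix.sum_mul, Matrix.mul_smul, Matrix.smul_mul]
    have h2 := congrArg Complex.re (congrFun (congrFun (hUC.symm.trans h1) j) j)
    simpa [Matrix.sum_apply] using h2
  have hmem : ∀ j, ∀ i ∈ s, (D i j j).re ∈ Set.Ici (0 : ℝ) := fun j i hi =>
    (Complex.nonneg_iff.1 ((hD i hi).diag_nonneg (i := j))).1
  have hentC := spectralEntropy_eq_sum_eigenvalues hCp.1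
  have hjen : ∀ j ∈ Finset.univ, ∑ i ∈ s, w i • Real.negMulLog (D i j j).re ≤
      Real.negMulLog (hCp.1.eigenvalues j) := fun j _ => by
    rw [hsum]
    exact Real.concaveOn_negMulLog.le_map_sum (fun i hi => (hw i hi).le) hw1 (hmem j)
  have hpei : ∀ i ∈ s, w i * spectralEntropy (B i) ≤
      w i * ∑ j, Real.negMulLog (D i j j).re := fun i hi => by
    refine mul_le_mul_of_nonneg_left ?_ (hw i hi).le
    rw [← spectralEntropy_conj_unitary U]
    exact (spectralEntropy_le_sum_diag (hD i hi)).1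
  have hswap : ∑ i ∈ s, w i * ∑ j, Real.negMulLog (D i j j).re =
      ∑ j, ∑ i ∈ s, w i • Real.negMulLog (D i j j).re := by
    simp only [Finset.mul_sum, smul_eq_mul]
    rw [Finset.sum_comm]
  have h1 := Finset.sum_le_sum hpei
  have h2 := Finset.sum_le_sum hjen
  rw [← hswap, ← hentC] at h2
  refine ⟨h1.trans h2, fun heq i hi => ?_⟩
  -- Both inequalities are now equalities: `e1` makes each `D i` diagonal, and `e2` identifies its
  -- diagonal with the eigenvalues of `C`.
  have e1 := (Finset.sum_eq_sum_iff_of_le hpei).1 (le_antisymm h1 (heq ▸ h2)) i hi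
  have e2 := (Finset.sum_eq_sum_iff_of_le hjen).1
    (by rw [← hswap, ← hentC]; exact le_antisymm h2 (heq ▸ h1))
  have hdi := (spectralEntropy_le_sum_diag (hD i hi)).2 (by
    rw [← mul_right_inj' (hw i hi).ne', ← e1]
    exact congrArg _ (spectralEntropy_conj_unitary U _))
  have hDC : D i = star (U : Matrix n n ℂ) * C * U := by
    rw [hdi, hUC]
    congr 1
    funext j
    have e3 := e2 j (Finset.mem_univ j)
    rw [hsum] at e3
    have := (Real.strictConcaveOn_negMulLog.map_sum_eq_iff_of_pos hw hw1 (hmem j)).1 e3.symm hi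
    have hmean : ∑ k ∈ s, w k • (D k j j).re = (D i j j).re := by
      rw [← Finset.sum_congr rfl fun k hk => congrArg (w k • ·) (this hk), ← Finset.sum_smul, hw1,
        one_smul]
    rw [hsum, hmean]
    exact (Complex.conj_eq_iff_re.1 ((hD i hi).1.apply j j)).symm
  have hcancel : ∀ M : Matrix n n ℂ,
      (U : Matrix n n ℂ) * (star (U : Matrix n n ℂ) * M * U) * star (U : Matrix n n ℂ) = M := by
    intro M
    rw [← mul_assoc, ← mul_assoc, Unitary.mul_star_self_of_mem U.2, one_mul, mul_assoc,
      Unitary.mul_star_self_of_mem U.2, mul_one]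
  rw [← hcancel (B i), ← hcancel C]
  exact congrArg (fun M => (U : Matrix n n ℂ) * M * star (U : Matrix n n ℂ)) hDC

/-- A uniform mixture (with the trace part of the entropy removed) has at least the entropy of its
parts, and equality forces the parts to coincide. -/
theorem sum_spectralEntropy_sub_le {ι : Type*} [Fintype ι] {s : Finset ι} (hs : s.Nonempty)
    {B : ι → Matrix n n ℂ} {p : ι → ℝ} {t : ℝ} (hB : ∀ i, (B i).PosSemidef)
    (hp : ∀ i, (B i).trace = (p i : ℂ)) (ht : ∀ i ∈ s, p i = t) (h0 : ∀ i ∉ s, p i = 0) :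
    ∑ i, (spectralEntropy (B i) - Real.negMulLog (p i)) ≤
        spectralEntropy (∑ i, B i) - Real.negMulLog (∑ i, p i) ∧
      (∑ i, (spectralEntropy (B i) - Real.negMulLog (p i)) =
          spectralEntropy (∑ i, B i) - Real.negMulLog (∑ i, p i) →
        ∀ i ∈ s, ∀ j ∈ s, B i = B j) := by
  have hN : (0 : ℝ) < s.card := by exact_mod_cast hs.card_pos
  have hB0 : ∀ i ∉ s, B i = 0 := fun i hi => by
    rw [← (hB i).trace_eq_zero_iff, hp, h0 i hi, Complex.ofReal_zero]
  have r1 : ∑ i, B i = ∑ i ∈ s, B i :=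
    (Finset.sum_subset (Finset.subset_univ s) fun i _ hi => hB0 i hi).symm
  have r2 : ∑ i, p i = s.card * t := by
    rw [← Finset.sum_subset (Finset.subset_univ s) fun i _ hi => h0 i hi, Finset.sum_congr rfl ht]
    simp
  have r3 : ∑ i, (spectralEntropy (B i) - Real.negMulLog (p i)) =
      ∑ i ∈ s, spectralEntropy (B i) - s.card * Real.negMulLog t := by
    rw [← Finset.sum_subset (Finset.subset_univ s) fun i _ hi => by
      simp [hB0 i hi, h0 i hi, spectralEntropy_zero], Finset.sum_sub_distrib]
    congr 1
    rw [Finset.sum_congr rfl fun i hi => by rw [ht i hi]]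
    simp
  obtain ⟨c1, c2⟩ := spectralEntropy_concave (s := s) (w := fun _ => (s.card : ℝ)⁻¹) (B := B)
    (fun _ _ => by positivity) (by simp [hN.ne']) (fun i _ => hB i)
  rw [← Finset.mul_sum, ← Finset.smul_sum] at c1 c2
  have hherm : (∑ i ∈ s, B i).IsHermitian := (posSemidef_sum _ fun i _ => hB i).1
  have htr : (∑ i ∈ s, B i).trace.re = s.card * t := by
    rw [← r1, trace_sum, ← r2]
    simp [hp]
  rw [spectralEntropy_smul hherm, htr] at c1 c2
  -- The trace corrections absorb exactly the entropy of the uniform weights on `s`.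
  have key : Real.negMulLog (s.card * t) =
      s.card * Real.negMulLog t - s.card * (Real.negMulLog (s.card : ℝ)⁻¹ * (s.card * t)) := by
    rw [Real.negMulLog_mul, Real.negMulLog, Real.negMulLog, Real.negMulLog, Real.log_inv]
    field_simp
    ring
  rw [r1, r2, r3, key]
  refine ⟨?_, fun heq => ?_⟩
  · have := mul_le_mul_of_nonneg_left c1 hN.le
    rw [mul_inv_cancel_left₀ hN.ne', mul_add, mul_inv_cancel_left₀ hN.ne'] at this
    linarith
  · have := c2 (by
      rw [← mul_right_inj' hN.ne', mul_inv_cancel_left₀ hN.ne', mul_add,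
        mul_inv_cancel_left₀ hN.ne']
      linarith)
    exact fun i hi j hj => (this i hi).trans (this j hj).symm

end SpectralEntropy

/-! ### Entropies of the reduced states of a two-party state -/

section Blocks

variable {m n : Type*} [Fintype m] [Fintype n] [DecidableEq m] [DecidableEq n]

theorem spectralEntropy_of_block_snd {ρ : Matrix (n × m) (n × m) ℂ}
    (h : ∀ i j, i.2 ≠ j.2 → ρ i j = 0) :
    spectralEntropy ρ = ∑ k, spectralEntropy (of fun i j => ρ (i, k) (j, k)) := by
  rw [← spectralEntropy_blockDiagonal]
  congr 1
  ext ⟨i, k⟩ ⟨j, l⟩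
  by_cases hk : k = l
  · subst hk; simp [blockDiagonal_apply]
  · simp [blockDiagonal_apply, hk, h (i, k) (j, l) hk]

theorem spectralEntropy_of_block_fst {ρ : Matrix (m × n) (m × n) ℂ}
    (h : ∀ i j, i.1 ≠ j.1 → ρ i j = 0) :
    spectralEntropy ρ = ∑ k, spectralEntropy (of fun i j => ρ (k, i) (k, j)) := by
  rw [← spectralEntropy_submatrix (Equiv.prodComm n m)]
  exact spectralEntropy_of_block_snd fun i j hij => h _ _ hij

end Blocks

section States

variable {X α Y β : Type*} [Fintype X] [Fintype α] [Fintype Y] [Fintype β]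
  [DecidableEq X] [DecidableEq α] [DecidableEq Y] [DecidableEq β]

/-- The amplitudes on the working registers that belong to the outcomes `x`, `y`. -/
def amplitudes (ψ : State X α Y β) (x : X) (y : Y) : Matrix α β ℂ :=
  of fun a b => ψ ((x, a), (y, b))

/-- The unnormalized state of `A'` given the outcomes `x`, `y`. -/
def aliceCond (ψ : State X α Y β) (x : X) (y : Y) : Matrix α α ℂ :=
  amplitudes ψ x y * (amplitudes ψ x y)ᴴ

/-- The unnormalized state of `B'` given the outcomes `x`, `y`. -/
def bobCond (ψ : State X α Y β) (x : X) (y : Y) : Matrix β β ℂ :=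
  ((amplitudes ψ x y)ᴴ * amplitudes ψ x y)ᵀ

/-- The reduced state of Alice. -/
def aliceState (ψ : State X α Y β) : Matrix (X × α) (X × α) ℂ :=
  of (fun i j => ψ (i, j)) * (of fun i j => ψ (i, j))ᴴ

theorem aliceCond_posSemidef (ψ : State X α Y β) (x : X) (y : Y) :
    (aliceCond ψ x y).PosSemidef := posSemidef_self_mul_conjTranspose _

theorem bobCond_posSemidef (ψ : State X α Y β) (x : X) (y : Y) :
    (bobCond ψ x y).PosSemidef := (posSemidef_conjTranspose_mul_self _).transpose

theorem spectralEntropy_bobCond (ψ : State X α Y β) (x : X) (y : Y) :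
    spectralEntropy (bobCond ψ x y) = spectralEntropy (aliceCond ψ x y) := by
  rw [bobCond, spectralEntropy_transpose, spectralEntropy_mul_comm, aliceCond]

theorem trace_bobCond (ψ : State X α Y β) (x : X) (y : Y) :
    (bobCond ψ x y).trace = (aliceCond ψ x y).trace := by
  rw [bobCond, trace_transpose, trace_mul_comm, aliceCond]

theorem trace_aliceCond (ψ : State X α Y β) (x : X) (y : Y) :
    (aliceCond ψ x y).trace = ((∑ a, ∑ b, ‖ψ ((x, a), (y, b))‖ ^ 2 : ℝ) : ℂ) := by
  simp [aliceCond, amplitudes, Matrix.trace, Matrix.mul_apply, Complex.mul_conj']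

/-- The state of `A` after the measurement is diagonal. -/
theorem spectralEntropy_outcome_left {P : X → Y → ℝ} {ψ : State X α Y β}
    (hP : ∀ x y, ∑ a, ∑ b, ‖ψ ((x, a), (y, b))‖ ^ 2 = P x y) {ρ : Matrix X X ℂ}
    (h0 : ∀ i j, i ≠ j → ρ i j = 0) (h1 : ∀ i, ρ i i = ∑ y, (aliceCond ψ i y).trace) :
    spectralEntropy ρ = ∑ x, Real.negMulLog (∑ y, P x y) := by
  have : ρ = diagonal fun x => ((∑ y, P x y : ℝ) : ℂ) := by
    ext i j
    by_cases hij : i = j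
    · subst hij; simp [h1, trace_aliceCond, hP]
    · simp [hij, h0 i j hij]
  rw [this, spectralEntropy_diagonal]
  simp only [Complex.ofReal_re]

theorem spectralEntropy_outcome_right {P : X → Y → ℝ} {ψ : State X α Y β}
    (hP : ∀ x y, ∑ a, ∑ b, ‖ψ ((x, a), (y, b))‖ ^ 2 = P x y) {ρ : Matrix Y Y ℂ}
    (h0 : ∀ i j, i ≠ j → ρ i j = 0) (h1 : ∀ i, ρ i i = ∑ x, (bobCond ψ x i).trace) :
    spectralEntropy ρ = ∑ y, Real.negMulLog (∑ x, P x y) := by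
  have : ρ = diagonal fun y => ((∑ x, P x y : ℝ) : ℂ) := by
    ext i j
    by_cases hij : i = j
    · subst hij; simp [h1, trace_bobCond, trace_aliceCond, hP]
    · simp [hij, h0 i j hij]
  rw [this, spectralEntropy_diagonal]
  simp only [Complex.ofReal_re]

/-- Measured registers make the states block diagonal, with one block per outcome. The blocks are
unnormalized, so their entropies already include the Shannon entropy of the outcomes. -/
theorem infoX_YB'_eq {P : X → Y → ℝ} {ψ : State X α Y β}
    (hP : ∀ x y, ∑ a, ∑ b, ‖ψ ((x, a), (y, b))‖ ^ 2 = P x y) :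
    infoX_YB' ψ = (∑ x, Real.negMulLog (∑ y, P x y) + ∑ y, spectralEntropy (∑ x, bobCond ψ x y)
      - ∑ x, ∑ y, spectralEntropy (bobCond ψ x y)) / Real.log 2 := by
  simp only [infoX_YB', quantumMutualInfo, vonNeumannEntropy_eq_spectralEntropy, ← add_div,
    ← sub_div]
  congr 3
  · refine spectralEntropy_outcome_left hP (fun i j hij => ?_) fun i => ?_
    · simp [traceRight, measured, hij]
    · simp [traceRight, measured, reducedABB', aliceCond, amplitudes, Matrix.trace,
        Matrix.mul_apply, Fintype.sum_prod_type, Finset.sum_comm (s := (Finset.univ : Finset β))]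
  · rw [spectralEntropy_of_block_fst fun i j hij => by simp [traceLeft, measured, hij]]
    refine Finset.sum_congr rfl fun y _ => congrArg _ ?_
    ext b b'
    simp [traceLeft, measured, reducedABB', bobCond, amplitudes, Matrix.sum_apply,
      Matrix.mul_apply]
  · rw [spectralEntropy_of_block_fst fun i j hij => by simp [measured, hij]]
    refine Finset.sum_congr rfl fun x _ => ?_
    rw [spectralEntropy_of_block_fst fun i j hij => by simp [measured, hij]]
    refine Finset.sum_congr rfl fun y _ => congrArg _ ?_
    ext b b'
    simp [measured, reducedABB', bobCond, amplitudes, Matrix.mul_apply, mul_comm]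

theorem infoXA'_Y_eq {P : X → Y → ℝ} {ψ : State X α Y β}
    (hP : ∀ x y, ∑ a, ∑ b, ‖ψ ((x, a), (y, b))‖ ^ 2 = P x y) :
    infoXA'_Y ψ = (∑ x, spectralEntropy (∑ y, aliceCond ψ x y) + ∑ y, Real.negMulLog (∑ x, P x y)
      - ∑ x, ∑ y, spectralEntropy (aliceCond ψ x y)) / Real.log 2 := by
  simp only [infoXA'_Y, quantumMutualInfo, vonNeumannEntropy_eq_spectralEntropy, ← add_div,
    ← sub_div]
  congr 3
  · rw [spectralEntropy_of_block_fst fun i j hij => by simp [traceRight, measured, hij]]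
    refine Finset.sum_congr rfl fun x _ => congrArg _ ?_
    ext a a'
    simp [traceRight, measured, reducedAA'B, aliceCond, amplitudes, Matrix.sum_apply,
      Matrix.mul_apply]
  · refine spectralEntropy_outcome_right hP (fun i j hij => ?_) fun i => ?_
    · simp [traceLeft, measured, hij]
    · simp [traceLeft, measured, reducedAA'B, bobCond, amplitudes, Matrix.trace,
        Matrix.mul_apply, Fintype.sum_prod_type,
        Finset.sum_comm (s := (Finset.univ : Finset β))]
  · rw [spectralEntropy_of_block_snd fun i j hij => by simp [measured, hij], Finset.sum_comm]
    refine Finset.sum_congr rfl fun x _ => ?_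
    rw [spectralEntropy_of_block_fst fun i j hij => by simp [measured, hij]]
    refine Finset.sum_congr rfl fun y _ => congrArg _ ?_
    ext b b'
    simp [measured, reducedAA'B, aliceCond, amplitudes, Matrix.mul_apply]

/-- Purity moves everything to Alice's side: `BB'` has the entropy of `AA'`, and, given `x`, that of
`A'`. -/
theorem infoX_BB'_eq {P : X → Y → ℝ} {ψ : State X α Y β}
    (hP : ∀ x y, ∑ a, ∑ b, ‖ψ ((x, a), (y, b))‖ ^ 2 = P x y) :
    infoX_BB' ψ = (∑ x, Real.negMulLog (∑ y, P x y) + spectralEntropy (aliceState ψ)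
      - ∑ x, spectralEntropy (∑ y, aliceCond ψ x y)) / Real.log 2 := by
  simp only [infoX_BB', quantumMutualInfo, vonNeumannEntropy_eq_spectralEntropy, ← add_div,
    ← sub_div]
  congr 3
  · refine spectralEntropy_outcome_left hP (fun i j hij => ?_) fun i => ?_
    · simp [traceRight, measured, hij]
    · simp [traceRight, measured, reducedABB', aliceCond, amplitudes, Matrix.trace,
        Matrix.mul_apply, Fintype.sum_prod_type, Finset.sum_comm (s := (Finset.univ : Finset β))]
  · rw [aliceState, spectralEntropy_mul_comm, ← spectralEntropy_transpose]
    congr 1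
    ext i j
    simp [traceLeft, measured, reducedABB', Matrix.mul_apply, Fintype.sum_prod_type, mul_comm]
  · rw [spectralEntropy_of_block_fst fun i j hij => by simp [measured, hij]]
    refine Finset.sum_congr rfl fun x _ => ?_
    let K : Matrix α (Y × β) ℂ := of fun a k => ψ ((x, a), k)
    trans spectralEntropy (Kᴴ * K)
    · rw [← spectralEntropy_transpose]
      congr 1
      ext i j
      simp [measured, reducedABB', K, Matrix.mul_apply, mul_comm]
    · rw [spectralEntropy_mul_comm]
      congr 1
      ext i j
      simp [aliceCond, amplitudes, K, Matrix.mul_apply, Matrix.sum_apply, Fintype.sum_prod_type]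

theorem infoAA'_Y_eq {P : X → Y → ℝ} {ψ : State X α Y β}
    (hP : ∀ x y, ∑ a, ∑ b, ‖ψ ((x, a), (y, b))‖ ^ 2 = P x y) :
    infoAA'_Y ψ = (spectralEntropy (aliceState ψ) + ∑ y, Real.negMulLog (∑ x, P x y)
      - ∑ y, spectralEntropy (∑ x, bobCond ψ x y)) / Real.log 2 := by
  simp only [infoAA'_Y, quantumMutualInfo, vonNeumannEntropy_eq_spectralEntropy, ← add_div,
    ← sub_div]
  congr 3
  · rw [aliceState]
    congr 1
    ext i j
    simp [traceRight, measured, reducedAA'B, Matrix.mul_apply, Fintype.sum_prod_type]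
  · refine spectralEntropy_outcome_right hP (fun i j hij => ?_) fun i => ?_
    · simp [traceLeft, measured, hij]
    · simp [traceLeft, measured, reducedAA'B, bobCond, amplitudes, Matrix.trace,
        Matrix.mul_apply, Fintype.sum_prod_type,
        Finset.sum_comm (s := (Finset.univ : Finset β))]
  · rw [spectralEntropy_of_block_snd fun i j hij => by simp [measured, hij]]
    refine Finset.sum_congr rfl fun y _ => ?_
    let K : Matrix (X × α) β ℂ := of fun k b => ψ (k, (y, b))
    trans spectralEntropy (K * Kᴴ)
    · congr 1
      ext i j
      simp [measured, reducedAA'B, K, Matrix.mul_apply]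
    · rw [spectralEntropy_mul_comm, ← spectralEntropy_transpose]
      congr 1
      ext i j
      simp [bobCond, amplitudes, K, Matrix.mul_apply, Matrix.sum_apply, Fintype.sum_prod_type,
        mul_comm]

end States

/-! ### The conditional states of an embedding -/

section Embedding

variable {X α Y β : Type*} [Fintype X] [Fintype α] [Fintype Y] [Fintype β]
  [DecidableEq X] [DecidableEq α] [DecidableEq Y] [DecidableEq β]

theorem log_two_ne_zero : Real.log 2 ≠ 0 := (Real.log_pos one_lt_two).ne'

theorem mutualInfo_eq (P : X → Y → ℝ) :
    mutualInfo P = (∑ x, Real.negMulLog (∑ y, P x y) + ∑ y, Real.negMulLog (∑ x, P x y)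
      - ∑ x, ∑ y, Real.negMulLog (P x y)) / Real.log 2 := by
  simp only [mutualInfo, shannonEntropy, ← add_div, ← sub_div, Fintype.sum_prod_type]

/-- If `P` is flat on the row support of each `y`, then Bob's working register of an embedding
depends on Bob's output only. -/
theorem IsEmbedding.bobCond_eq {P : X → Y → ℝ} {ψ : State X α Y β} (h : IsEmbedding P ψ)
    {s : Y → Finset X} (hs : ∀ y, (s y).Nonempty) {t : Y → ℝ} (ht : ∀ y, ∀ x ∈ s y, P x y = t y)
    (h0 : ∀ y, ∀ x ∉ s y, P x y = 0) {y : Y} {x x' : X} (hx : x ∈ s y) (hx' : x' ∈ s y) :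
    bobCond ψ x y = bobCond ψ x' y := by
  have key := fun y => sum_spectralEntropy_sub_le (hs y) (B := fun x => bobCond ψ x y)
    (p := fun x => P x y) (fun x => bobCond_posSemidef ψ x y)
    (fun x => by rw [trace_bobCond, trace_aliceCond, h.outcome]) (ht y) (h0 y)
  have heq := h.bob
  rw [infoX_YB'_eq h.outcome, mutualInfo_eq, div_left_inj' log_two_ne_zero,
    Finset.sum_comm (f := fun x y => spectralEntropy (bobCond ψ x y)),
    Finset.sum_comm (f := fun x y => Real.negMulLog (P x y))] at heq
  refine (key y).2 ?_ x hx x' hx'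
  -- The embedding condition is equality in the sum over `y` of the inequalities `key y`, so each of
  -- them is an equality.
  refine (Finset.sum_eq_sum_iff_of_le fun y _ => (key y).1).1 ?_ y (Finset.mem_univ y)
  simp only [Finset.sum_sub_distrib]
  linarith

/-- If `P` is flat on the column support of each `x`, then Alice's working register of an
embedding depends on Alice's output only. -/
theorem IsEmbedding.aliceCond_eq {P : X → Y → ℝ} {ψ : State X α Y β} (h : IsEmbedding P ψ)
    {s : X → Finset Y} (hs : ∀ x, (s x).Nonempty) {t : X → ℝ} (ht : ∀ x, ∀ y ∈ s x, P x y = t x)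
    (h0 : ∀ x, ∀ y ∉ s x, P x y = 0) {x : X} {y y' : Y} (hy : y ∈ s x) (hy' : y' ∈ s x) :
    aliceCond ψ x y = aliceCond ψ x y' := by
  have key := fun x => sum_spectralEntropy_sub_le (hs x) (B := fun y => aliceCond ψ x y)
    (p := fun y => P x y) (fun y => aliceCond_posSemidef ψ x y)
    (fun y => by rw [trace_aliceCond, h.outcome]) (ht x) (h0 x)
  have heq := h.alice
  rw [infoXA'_Y_eq h.outcome, mutualInfo_eq, div_left_inj' log_two_ne_zero] at heq
  refine (key x).2 ?_ y hy y' hy'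
  refine (Finset.sum_eq_sum_iff_of_le fun x _ => (key x).1).1 ?_ x (Finset.mem_univ x)
  simp only [Finset.sum_sub_distrib]
  linarith

end Embedding

/-! ### Entropy of Kronecker products -/

section Kronecker

variable {m n : Type*} [Fintype m] [Fintype n] [DecidableEq m] [DecidableEq n]

open scoped Kronecker

/-- Diagonalizing `A` alone turns the product into a direct sum of copies of `S` scaled by the
eigenvalues of `A`. -/
theorem spectralEntropy_kronecker {A : Matrix m m ℂ} {S : Matrix n n ℂ} (hA : A.IsHermitian)
    (hS : S.IsHermitian) :
    spectralEntropy (A ⊗ₖ S) =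
      A.trace.re * spectralEntropy S + spectralEntropy A * S.trace.re := by
  set U : Matrix m m ℂ := (hA.eigenvectorUnitary : Matrix m m ℂ) with hU
  have hAU : A = U * diagonal (fun i => (hA.eigenvalues i : ℂ)) * star U := by
    conv_lhs => rw [hA.spectral_theorem, Unitary.conjStarAlgAut_apply]
    rfl
  have hk : A ⊗ₖ S = (U ⊗ₖ (1 : Matrix n n ℂ)) *
      ((diagonal (fun i => (hA.eigenvalues i : ℂ)) ⊗ₖ S) * (star U ⊗ₖ (1 : Matrix n n ℂ))) := by
    rw [← mul_kronecker_mul, ← mul_kronecker_mul, one_mul, mul_one, ← mul_assoc, ← hAU]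
  rw [hk, spectralEntropy_mul_comm, mul_assoc, ← mul_kronecker_mul,
    Unitary.star_mul_self_of_mem hA.eigenvectorUnitary.2, one_mul, one_kronecker_one, mul_one,
    spectralEntropy_of_block_fst fun i j hij => by simp [kroneckerMap_apply, hij]]
  have : ∀ k, spectralEntropy (of fun i j =>
      (diagonal (fun i => (hA.eigenvalues i : ℂ)) ⊗ₖ S) (k, i) (k, j)) =
      hA.eigenvalues k * spectralEntropy S + Real.negMulLog (hA.eigenvalues k) * S.trace.re := by
    intro k
    rw [← spectralEntropy_smul hS]
    congr 1
    ext i j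
    simp [kroneckerMap_apply]
  simp only [this, Finset.sum_add_distrib, ← Finset.sum_mul]
  rw [← spectralEntropy_eq_sum_eigenvalues hA, hA.trace_eq_sum_eigenvalues]
  simp

/-- The rank-one all-ones matrix shifts a single eigenvalue of the identity; the others stay 1 and
contribute nothing. -/
theorem spectralEntropy_one_add_vecMulVec_one [Nonempty n] :
    spectralEntropy (1 + vecMulVec 1 1 : Matrix n n ℂ) =
      Real.negMulLog (Fintype.card n + 1) := by
  have h : (1 + vecMulVec 1 1 : Matrix n n ℂ) = vecMulVec 1 1 - scalar n (-1) := by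
    rw [map_neg, map_one, sub_neg_eq_add, add_comm]
  obtain ⟨k, hk⟩ := Nat.exists_eq_succ_of_ne_zero (Fintype.card_ne_zero (α := n))
  have hc : (1 + vecMulVec 1 1 : Matrix n n ℂ).charpoly =
      ((X - C 1) ^ k * (X - C ((Fintype.card n : ℂ) + 1)) : ℂ[X]) := by
    rw [h, charpoly_sub_scalar, charpoly_vecMulVec, hk]
    simp [pow_succ, smul_eq_C_mul, hk]
    ring
  rw [spectralEntropy, hc, roots_mul (mul_ne_zero (pow_ne_zero _ (X_sub_C_ne_zero _))
    (X_sub_C_ne_zero _)), roots_pow, roots_X_sub_C, roots_X_sub_C]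
  simp [Multiset.map_nsmul, Multiset.sum_nsmul]

end Kronecker

section Erasure

variable {X α β : Type*} [Fintype X] [Fintype α] [Fintype β]
  [DecidableEq X] [DecidableEq α] [DecidableEq β]

open scoped Kronecker

/-- Alice's reduced state, up to vanishing eigenvalues, is `(1 + J) ⊗ σ`, where `J` is the all-ones
matrix and `σ` the common state of Bob's working register at an erasure. -/
theorem spectralEntropy_aliceState_erasure [Nonempty X] {ψ : State X α (Option X) β}
    {σ : Matrix β β ℂ} (h0 : ∀ x x', x ≠ x' → amplitudes ψ x (some x') = 0)
    (hA : ∀ x, aliceCond ψ x (some x) = aliceCond ψ x none) (hB : ∀ x, bobCond ψ x none = σ) :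
    spectralEntropy (aliceState ψ) = 2 * Fintype.card X * spectralEntropy σ +
      Real.negMulLog (Fintype.card X + 1) * σ.trace.re := by
  -- `D` holds the erasure amplitudes, one block per `x`. Alice's state is D ((1 + J) ⊗ 1) D*, and
  -- moving `D` around leaves (1 + J) ⊗ σᵀ because of `hDD`.
  let D : Matrix (X × α) (X × β) ℂ :=
    of fun i j => if i.1 = j.1 then amplitudes ψ i.1 none i.2 j.2 else 0
  have hσ : σ.IsHermitian := by
    obtain ⟨x⟩ := ‹Nonempty X›
    exact hB x ▸ (bobCond_posSemidef ψ x none).1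
  have hDD : Dᴴ * D = (1 : Matrix X X ℂ) ⊗ₖ σᵀ := by
    ext ⟨x, b⟩ ⟨x', b'⟩
    by_cases hx : x = x'
    · subst hx
      simp [D, Matrix.mul_apply, Fintype.sum_prod_type, kroneckerMap_apply, ← hB x, bobCond]
    · simp [D, Matrix.mul_apply, Fintype.sum_prod_type, kroneckerMap_apply, hx, Ne.symm hx]
  have hρ : aliceState ψ =
      D * (((1 + vecMulVec 1 1 : Matrix X X ℂ) ⊗ₖ (1 : Matrix β β ℂ)) * Dᴴ) := by
    ext ⟨x, a⟩ ⟨x', a'⟩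
    have hr : (D * (((1 + vecMulVec 1 1 : Matrix X X ℂ) ⊗ₖ (1 : Matrix β β ℂ)) * Dᴴ))
        (x, a) (x', a') = (if x = x' then aliceCond ψ x none a a' else 0) +
          ∑ b, amplitudes ψ x none a b * star (amplitudes ψ x' none a' b) := by
      have h1 : ∀ x₁ b, ((((1 + vecMulVec 1 1 : Matrix X X ℂ) ⊗ₖ (1 : Matrix β β ℂ)) * Dᴴ))
          (x₁, b) (x', a') = ((if x₁ = x' then 1 else 0) + 1) *
            star (amplitudes ψ x' none a' b) := by
        intro x₁ b
        simp [D, Matrix.mul_apply, Fintype.sum_prod_type, kroneckerMap_apply, one_apply,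
          apply_ite (starRingEnd ℂ)]
      rw [Matrix.mul_apply, Fintype.sum_prod_type]
      simp only [h1, D]
      by_cases hx : x = x'
      · subst hx
        simp [aliceCond, Matrix.mul_apply, add_mul, mul_add, Finset.sum_add_distrib]
      · simp [hx]
    have hl : aliceState ψ (x, a) (x', a') =
        (∑ z, ∑ b, amplitudes ψ x (some z) a b * star (amplitudes ψ x' (some z) a' b)) +
          ∑ b, amplitudes ψ x none a b * star (amplitudes ψ x' none a' b) := by
      simp [aliceState, Matrix.mul_apply, Fintype.sum_prod_type, Fintype.sum_option, amplitudes,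
        add_comm]
    rw [hr, hl, add_left_inj, Finset.sum_eq_single x]
    · by_cases hx : x = x'
      · subst hx
        rw [if_pos rfl, ← hA]
        simp [aliceCond, Matrix.mul_apply]
      · simp [hx, h0 x' x (Ne.symm hx)]
    · intro z _ hz
      simp [h0 x z (Ne.symm hz)]
    · simp
  rw [hρ, spectralEntropy_mul_comm, Matrix.mul_assoc, hDD, ← mul_kronecker_mul, mul_one, one_mul,
    spectralEntropy_kronecker _ hσ.transpose, spectralEntropy_one_add_vecMulVec_one,
    spectralEntropy_transpose, trace_transpose]
  · congr 2
    simp [Matrix.trace]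
    ring
  · ext i j
    simp [one_apply, eq_comm]

end Erasure

/-! ### Rabin string OT -/

section RegularEmbedding

variable {X Y : Type*} [Fintype X] [Fintype Y] [DecidableEq X] [DecidableEq Y]

theorem spectralEntropy_unit (ρ : Matrix Unit Unit ℂ) :
    spectralEntropy ρ = Real.negMulLog ρ.trace.re := by
  have : ρ = diagonal fun i => ρ i i := by ext; simp
  rw [this, spectralEntropy_diagonal]
  simp

theorem regularEmbedding_outcome {P : X → Y → ℝ} (hP : ∀ x y, 0 ≤ P x y) (θ : X → Y → ℝ)
    (x : X) (y : Y) :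
    ∑ a, ∑ b, ‖regularEmbedding P θ ((x, a), (y, b))‖ ^ 2 = P x y := by
  simp [regularEmbedding, Complex.norm_exp, Real.sq_sqrt (hP x y)]

/-- With trivial working registers the two conditions on an embedding hold for free. -/
theorem isEmbedding_regularEmbedding {P : X → Y → ℝ} (hP : ∀ x y, 0 ≤ P x y) (θ : X → Y → ℝ) :
    IsEmbedding P (regularEmbedding P θ) where
  outcome := regularEmbedding_outcome hP θ
  bob := by
    rw [infoX_YB'_eq (regularEmbedding_outcome hP θ), mutualInfo_eq]
    simp only [spectralEntropy_unit, trace_sum, trace_bobCond, trace_aliceCond,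
      regularEmbedding_outcome hP θ, ← Complex.ofReal_sum, Complex.ofReal_re]
  alice := by
    rw [infoXA'_Y_eq (regularEmbedding_outcome hP θ), mutualInfo_eq]
    simp only [spectralEntropy_unit, trace_sum, trace_aliceCond,
      regularEmbedding_outcome hP θ, ← Complex.ofReal_sum, Complex.ofReal_re]

end RegularEmbedding

section Rabin

variable {r : ℕ} {α β : Type*} [Fintype α] [Fintype β] [DecidableEq α] [DecidableEq β]

theorem rabinOT_nonneg (r : ℕ) (x : BitString r) (y : Option (BitString r)) :
    0 ≤ rabinOT r x y := by
  unfold rabinOT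
  split_ifs <;> positivity

theorem rabinOT_none (x : BitString r) : rabinOT r x none = 1 / 2 ^ (r + 1) := by
  simp [rabinOT]

theorem rabinOT_some (x x' : BitString r) :
    rabinOT r x (some x') = if x' = x then 1 / 2 ^ (r + 1) else 0 := by
  simp [rabinOT]

/-- The leakage of Rabin string OT, in closed form. -/
noncomputable def rabinLeakage (r : ℕ) : ℝ :=
  r / 2 + 1 - (2 ^ r + 1) / (2 * 2 ^ r) * Real.logb 2 (2 ^ r + 1)

theorem sum_negMulLog_rabinOT_left :
    ∑ x, Real.negMulLog (∑ y, rabinOT r x y) = r * Real.log 2 := by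
  have : ∀ x : BitString r, ∑ y, rabinOT r x y = (2 ^ r)⁻¹ := fun x => by
    simp [Fintype.sum_option, rabinOT_none, rabinOT_some]
    field_simp
    ring
  simp [this, Real.negMulLog, Real.log_inv, Real.log_pow]

theorem sum_rabinOT_none : ∑ x, rabinOT r x none = 2⁻¹ := by
  simp [rabinOT_none]
  field_simp
  ring

theorem sum_negMulLog_rabinOT_right :
    ∑ y, Real.negMulLog (∑ x, rabinOT r x y) = (r / 2 + 1) * Real.log 2 := by
  rw [Fintype.sum_option, sum_rabinOT_none]
  simp [rabinOT_some, Real.negMulLog, Real.log_inv, Real.log_pow]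
  field_simp
  ring

theorem mutualInfo_rabinOT (r : ℕ) : mutualInfo (rabinOT r) = r / 2 := by
  rw [mutualInfo_eq, sum_negMulLog_rabinOT_left, sum_negMulLog_rabinOT_right,
    div_eq_iff log_two_ne_zero]
  simp [Fintype.sum_option, rabinOT_none, rabinOT_some, Real.negMulLog,
    Real.log_inv, Real.log_pow]
  field_simp
  ring

theorem IsEmbedding.rabinOT_leakage_eq {ψ : State (BitString r) α (Option (BitString r)) β}
    (h : IsEmbedding (rabinOT r) ψ) : leakage (rabinOT r) ψ = rabinLeakage r := by
  -- At ⊥ every string is possible; at a received string only that string is.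
  have hB : ∀ x, bobCond ψ x none = bobCond ψ default none := fun x =>
    h.bobCond_eq (s := fun y => y.elim Finset.univ fun x => {x}) (t := fun _ => 1 / 2 ^ (r + 1))
      (by rintro (_ | x) <;> simp) (by rintro (_ | x) <;> simp [rabinOT_none, rabinOT_some])
      (by rintro (_ | x) <;> simp +contextual [rabinOT_some, eq_comm]) (by simp) (by simp)
  have hA : ∀ x, aliceCond ψ x (some x) = aliceCond ψ x none := fun x =>
    h.aliceCond_eq (s := fun x => {some x, none}) (t := fun _ => 1 / 2 ^ (r + 1))
      (by simp) (by simp [rabinOT_none, rabinOT_some])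
      (by rintro x (_ | y) <;> simp +contextual [rabinOT_some]) (by simp) (by simp)
  have h0 : ∀ x x', x ≠ x' → amplitudes ψ x (some x') = 0 := fun x x' hx => by
    rw [← self_mul_conjTranspose_eq_zero, ← aliceCond,
      ← (aliceCond_posSemidef ψ x _).trace_eq_zero_iff, trace_aliceCond, h.outcome, rabinOT_some,
      if_neg hx.symm, Complex.ofReal_zero]
  set σ := bobCond ψ default none with hσ
  have htr : σ.trace.re = 1 / (2 * 2 ^ r) := by
    rw [hσ, trace_bobCond, trace_aliceCond, h.outcome, rabinOT_none, Complex.ofReal_re, pow_succ']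
  have hσh : σ.IsHermitian := (bobCond_posSemidef ψ _ _).1
  have eA : ∀ x, spectralEntropy (aliceCond ψ x none) = spectralEntropy σ := fun x => by
    rw [← spectralEntropy_bobCond, hB]
  have hcard : (Fintype.card (BitString r) : ℝ) = 2 ^ r := by simp
  have e1 := spectralEntropy_aliceState_erasure h0 hA hB
  have e2 : ∑ x, spectralEntropy (∑ y, aliceCond ψ x y) =
      2 ^ r * (2 * spectralEntropy σ) - Real.log 2 := by
    have : ∀ x, spectralEntropy (∑ y, aliceCond ψ x y) =
        2 * spectralEntropy σ - 2 * Real.log 2 * (1 / (2 * 2 ^ r)) := fun x => by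
      have hs : ∑ y, aliceCond ψ x y = ((2 : ℝ) : ℂ) • aliceCond ψ x none := by
        rw [Fintype.sum_option, Finset.sum_eq_single x (fun x' _ hx => by
          rw [aliceCond, h0 x x' hx.symm, Matrix.zero_mul]) (by simp), hA, Complex.ofReal_ofNat,
          two_smul]
      rw [hs, spectralEntropy_smul (aliceCond_posSemidef ψ x none).1, eA, ← trace_bobCond, hB, htr,
        Real.negMulLog]
      ring
    simp only [this, Finset.sum_const, Finset.card_univ, nsmul_eq_mul, hcard]
    field_simp
  have e3 : ∑ y, spectralEntropy (∑ x, bobCond ψ x y) =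
      2 ^ r * (2 * spectralEntropy σ) - r / 2 * Real.log 2 := by
    have hs : ∑ x, bobCond ψ x none = ((2 ^ r : ℝ) : ℂ) • σ := by
      rw [Finset.sum_congr rfl fun x _ => hB x, Finset.sum_const, Finset.card_univ, ← hcard,
        Complex.ofReal_natCast, Nat.cast_smul_eq_nsmul]
    have hs' : ∀ z, spectralEntropy (∑ x, bobCond ψ x (some z)) = spectralEntropy σ := fun z => by
      rw [Finset.sum_eq_single z (fun x _ hx => by
        rw [bobCond, h0 x z hx, Matrix.mul_zero, transpose_zero]) (by simp),
        spectralEntropy_bobCond, hA, eA]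
    rw [Fintype.sum_option, hs, spectralEntropy_smul hσh, htr,
      Finset.sum_congr rfl fun z _ => hs' z, Finset.sum_const, Finset.card_univ, nsmul_eq_mul, hcard,
      Real.negMulLog, Real.log_pow]
    field_simp
    ring
  rw [htr, hcard] at e1
  have hl := log_two_ne_zero
  have e4 : infoX_BB' ψ - mutualInfo (rabinOT r) = rabinLeakage r := by
    rw [infoX_BB'_eq h.outcome, e1, e2, mutualInfo_rabinOT, sum_negMulLog_rabinOT_left,
      rabinLeakage, Real.negMulLog, Real.logb]
    field_simp
    ring
  have e5 : infoAA'_Y ψ - mutualInfo (rabinOT r) = rabinLeakage r := by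
    rw [infoAA'_Y_eq h.outcome, e1, e3, mutualInfo_rabinOT, sum_negMulLog_rabinOT_right,
      rabinLeakage, Real.negMulLog, Real.logb]
    field_simp
    ring
  rw [leakage, e4, e5, max_self]

/-! ### Bounds and numerical value of the closed form -/

theorem rabinLeakage_le_one (r : ℕ) : rabinLeakage r ≤ 1 := by
  have h : (r : ℝ) ≤ Real.logb 2 (2 ^ r + 1) := by
    rw [Real.le_logb_iff_rpow_le one_lt_two (by positivity), Real.rpow_natCast]
    linarith
  have hN : (0 : ℝ) < 2 ^ r := by positivity
  have h2 : (1 : ℝ) / 2 ≤ (2 ^ r + 1) / (2 * 2 ^ r) := by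
    rw [div_le_div_iff₀ two_pos (by positivity)]
    linarith
  have := mul_le_mul h2 h r.cast_nonneg (by positivity)
  unfold rabinLeakage
  linarith

theorem one_sub_le_rabinLeakage {r : ℕ} (hr : 1 ≤ r) :
    1 - 3 * ((r : ℝ) / 2 ^ r) ≤ rabinLeakage r := by
  have hN : (0 : ℝ) < 2 ^ r := by positivity
  have hN1 : (1 : ℝ) ≤ 2 ^ r := one_le_pow₀ one_le_two
  have hr' : (1 : ℝ) ≤ r := by exact_mod_cast hr
  -- From ln(1 + ε) ≤ ε with ε = 2^(-r), and 1 / ln 2 < 2.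
  have h : Real.logb 2 (2 ^ r + 1) ≤ r + 2 / 2 ^ r := by
    have e : (2 : ℝ) ^ r + 1 = 2 ^ r * (1 + 1 / 2 ^ r) := by field_simp
    have h1 : Real.log (1 + 1 / 2 ^ r) ≤ 1 / 2 ^ r := by
      have := Real.log_le_sub_one_of_pos (x := 1 + 1 / 2 ^ r) (by positivity)
      linarith
    have h2 : (1 : ℝ) / 2 < Real.log 2 := by have := Real.log_two_gt_d9; linarith
    rw [Real.logb, div_le_iff₀ (by linarith), e, Real.log_mul (by positivity) (by positivity),
      Real.log_pow, add_mul]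
    have : (2 : ℝ) / 2 ^ r * (1 / 2) ≤ 2 / 2 ^ r * Real.log 2 := by gcongr
    have e' : (2 : ℝ) / 2 ^ r * (1 / 2) = 1 / 2 ^ r := by ring
    linarith
  have h3 : (2 ^ r + 1) / (2 * 2 ^ r) * Real.logb 2 (2 ^ r + 1) ≤
      (2 ^ r + 1) / (2 * 2 ^ r) * (r + 2 / 2 ^ r) := by gcongr
  have h4 : ((2 : ℝ) ^ r + 1) / (2 * 2 ^ r) * (r + 2 / 2 ^ r) =
      r / 2 + (r / 2 + 1 + 1 / 2 ^ r) / 2 ^ r := by field_simp; ring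
  -- The constant 3 is generous: the numerator is at most r/2 + 2 ≤ 5r/2, using r ≥ 1.
  have h5 : (r / 2 + 1 + 1 / 2 ^ r) / 2 ^ r ≤ 3 * ((r : ℝ) / 2 ^ r) := by
    rw [← mul_div_assoc]
    gcongr
    have : 1 / (2 : ℝ) ^ r ≤ 1 := by rw [div_le_one hN]; exact hN1
    linarith
  unfold rabinLeakage
  linarith

theorem rabinLeakage_one : rabinLeakage 1 = binEntropyBits (1 / 4) - 1 / 2 := by
  have hl := log_two_ne_zero
  have h4 : Real.log 4 = 2 * Real.log 2 := by
    rw [show (4 : ℝ) = 2 ^ 2 by norm_num, Real.log_pow]; norm_num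
  rw [rabinLeakage, binEntropyBits, Real.binEntropy, Real.logb]
  norm_num
  rw [Real.log_div (by norm_num) (by norm_num), h4]
  field_simp
  ring

theorem abs_rabinLeakage_one_sub_lt : |rabinLeakage 1 - 0.311| < 0.0005 := by
  have hl : 0 < Real.log 2 := Real.log_pos one_lt_two
  -- 84/53 and 65/41 are consecutive continued-fraction convergents of log₂ 3, one on each side.
  have h1 : (84 / 53 : ℝ) < Real.logb 2 3 := by
    have := Real.log_lt_log (by norm_num) (show (2 : ℝ) ^ 84 < 3 ^ 53 by norm_num)
    rw [Real.log_pow, Real.log_pow] at this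
    rw [Real.logb, lt_div_iff₀ hl]
    push_cast at this
    linarith
  have h2 : Real.logb 2 3 < 65 / 41 := by
    have := Real.log_lt_log (by norm_num) (show (3 : ℝ) ^ 41 < 2 ^ 65 by norm_num)
    rw [Real.log_pow, Real.log_pow] at this
    rw [Real.logb, div_lt_iff₀ hl]
    push_cast at this
    linarith
  have : rabinLeakage 1 = 3 / 2 - 3 / 4 * Real.logb 2 3 := by
    norm_num [rabinLeakage]
  rw [this, abs_lt]
  constructor <;> linarith

end Rabin

end RabinLeakage

theorem mainTheorem4 :
    ∃ (L : ℕ → ℝ) (C : ℝ),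
      (∀ r : ℕ, 1 ≤ r →
        -- every state with a phase function is an embedding, and its leakage is `L r`
        (∀ θ : RabinLeakage.BitString r → Option (RabinLeakage.BitString r) → ℝ,
          RabinLeakage.IsEmbedding (RabinLeakage.rabinOT r)
            (RabinLeakage.regularEmbedding (RabinLeakage.rabinOT r) θ) ∧
          RabinLeakage.leakage (RabinLeakage.rabinOT r)
            (RabinLeakage.regularEmbedding (RabinLeakage.rabinOT r) θ) = L r) ∧
        -- every embedding, with arbitrary working registers, has leakage `L r`
        (∀ (α β : Type) [Fintype α] [Fintype β] [DecidableEq α] [DecidableEq β]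
          (ψ : RabinLeakage.State (RabinLeakage.BitString r) α
            (Option (RabinLeakage.BitString r)) β),
          RabinLeakage.IsEmbedding (RabinLeakage.rabinOT r) ψ →
          RabinLeakage.leakage (RabinLeakage.rabinOT r) ψ = L r) ∧
        -- `L r = 1 - O(r 2^(-r))`
        1 - C * ((r : ℝ) / 2 ^ r) ≤ L r ∧ L r ≤ 1) ∧
      L 1 = RabinLeakage.binEntropyBits (1 / 4) - 1 / 2 ∧
      |L 1 - 0.311| < 0.0005 := by
  refine ⟨RabinLeakage.rabinLeakage, 3, fun r hr => ⟨fun θ => ?_, fun α β _ _ _ _ ψ h => ?_,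
    RabinLeakage.one_sub_le_rabinLeakage hr, RabinLeakage.rabinLeakage_le_one r⟩,
    RabinLeakage.rabinLeakage_one, RabinLeakage.abs_rabinLeakage_one_sub_lt⟩
  · have h := RabinLeakage.isEmbedding_regularEmbedding (RabinLeakage.rabinOT_nonneg r) θ
    exact ⟨h, h.rabinOT_leakage_eq⟩
  · exact h.rabinOT_leakage_eq
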